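/- Let $d\ge 1$, $h_0>0$, $\lambda_0>0$, and let $\Omega\subset\mathbb R^d$ be a nonempty bounded open set that is strictly convex (convex, with no line segment on its boundary) and has $C^{1,1}$ boundary. For $x_0\in\partial\Omega$ consider the affine functions $H(x)=h_0+p\cdot(x-x_0)$ with $|p|=\lambda_0$ and $H\ge h_0$ on $\Omega$; their graphs are the support hyperplanes of slope $\lambda_0$ to $\Omega\times\{h_0\}$ at $(x_0,h_0)$ that lie above $\Omega$. Let $h_*:\mathbb R^d\to\mathbb R$ be the infimum of all these functions $H$ over all $x_0\in\partial\Omega$, and let $\Gamma=\partial\{h_*>0\}\setminus\overline\Omega$ be its free boundary. A bounded convex domain $U$ is said to roll freely inside a ball of radius $R$ if for every $X\in\partial U$ there is $Z\in\mathbb R^d$ with $U\subset B(Z,R)$ and $X\in\partial B(Z,R)$. The boundary of a bounded convex domain $U$ is said to be strictly convex, or to roll freely inside a ball of radius $R$, if $U$ is strictly convex, or rolls freely inside a ball of radius $R$, respectively. Then $\Gamma$ is the boundary of a bounded convex domain and is strictly convex. Moreover, if $\Omega$ rolls freely inside a ball of radius $R>0$, then $\Gamma$ rolls freely inside a ball of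 radius $R+\dfrac{h_0}{\lambda_0}$, and, if $R\ge 1$, also inside a ball of radius $\dfrac{R(\lambda_0+h_0)}{\lambda_0}$. -/

import Mathlib

open scoped RealInnerProductSpace

/-- A nonempty bounded convex domain (open set) of `ℝ^d`. -/
structure IsBoundedConvexDomain {d : ℕ} (Ω : Set (EuclideanSpace ℝ (Fin d))) : Prop where
  isOpen : IsOpen Ω
  nonempty : Ω.Nonempty
  isBounded : Bornology.IsBounded Ω
  convex : Convex ℝ Ω

/-- The boundary of `Ω` is `C^{1,1}`: near each boundary point, `Ω` is, for some unit vector `e`,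
the set of points lying above the graph, over the hyperplane orthogonal to `e`, of a `C^1` function
`φ` with Lipschitz derivative. The point `x - ⟪e, x⟫ e` is the orthogonal projection of `x` to that
hyperplane. -/
def HasC11Boundary {d : ℕ} (Ω : Set (EuclideanSpace ℝ (Fin d))) : Prop :=
  ∀ x₀ ∈ frontier Ω, ∃ (e : EuclideanSpace ℝ (Fin d)) (φ : EuclideanSpace ℝ (Fin d) → ℝ) (r : ℝ),
    ‖e‖ = 1 ∧ 0 < r ∧ ContDiff ℝ 1 φ ∧ (∃ L : NNReal, LipschitzWith L (fderiv ℝ φ)) ∧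
      ∀ x ∈ Metric.ball x₀ r, x ∈ Ω ↔ φ (x - ⟪e, x⟫ • e) < ⟪e, x⟫

/-- `Ω` is a strictly convex bounded domain: its closure has no segment on the boundary.
(`StrictConvex ℝ Ω` itself would hold for every open convex set, hence the closure.) -/
def IsStrictlyConvexDomain {d : ℕ} (Ω : Set (EuclideanSpace ℝ (Fin d))) : Prop :=
  IsBoundedConvexDomain Ω ∧ StrictConvex ℝ (closure Ω)

/-- `Ω` rolls freely inside a ball of radius `R`: at each boundary point `X` there is a ball of
radius `R` that contains `Ω` and has `X` on its boundary. -/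
def RollsFreely {d : ℕ} (Ω : Set (EuclideanSpace ℝ (Fin d))) (R : ℝ) : Prop :=
  ∀ X ∈ frontier Ω, ∃ Z : EuclideanSpace ℝ (Fin d),
    Ω ⊆ Metric.ball Z R ∧ X ∈ Metric.sphere Z R

/-- The affine function `x ↦ h₀ + ⟪p, x - x₀⟫`; its graph is the hyperplane of `ℝ^(d+1)` through
`(x₀, h₀)` with slope vector `p`. -/
noncomputable def planeThrough {d : ℕ} (h₀ : ℝ) (x₀ p x : EuclideanSpace ℝ (Fin d)) : ℝ :=
  h₀ + ⟪p, x - x₀⟫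

/-- The hyperplane through `(x₀, h₀)` with slope vector `p` has slope `lam` (the length of `p`) and
supports `Ω × {h₀}` at `(x₀, h₀)`, staying above it. -/
def IsSupportPlane {d : ℕ} (Ω : Set (EuclideanSpace ℝ (Fin d))) (h₀ lam : ℝ)
    (x₀ p : EuclideanSpace ℝ (Fin d)) : Prop :=
  x₀ ∈ frontier Ω ∧ ‖p‖ = lam ∧ ∀ y ∈ Ω, h₀ ≤ planeThrough h₀ x₀ p y

/-- The function `h_*`: the lower envelope of all support hyperplanes of slope `lam` to `Ω × {h₀}`
at the points of its boundary. -/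
noncomputable def hStar {d : ℕ} (Ω : Set (EuclideanSpace ℝ (Fin d))) (h₀ lam : ℝ)
    (x : EuclideanSpace ℝ (Fin d)) : ℝ :=
  sInf {t : ℝ | ∃ x₀ p, IsSupportPlane Ω h₀ lam x₀ p ∧ t = planeThrough h₀ x₀ p x}

/-- The free boundary `Γ_u = ∂{u > 0} \ closure Ω`. -/
def freeBoundary {d : ℕ} (Ω : Set (EuclideanSpace ℝ (Fin d)))
    (u : EuclideanSpace ℝ (Fin d) → ℝ) : Set (EuclideanSpace ℝ (Fin d)) :=
  frontier {x | 0 < u x} \ closure Ω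

/-- A hypersurface is strictly convex if it is the boundary of a strictly convex bounded domain. -/
def IsStrictlyConvexSurface {d : ℕ} (Γ : Set (EuclideanSpace ℝ (Fin d))) : Prop :=
  ∃ U, frontier U = Γ ∧ IsStrictlyConvexDomain U

/-- A convex hypersurface rolls freely inside a ball of radius `R` if it is the boundary of a
bounded convex domain that does so. -/
def SurfaceRollsFreely {d : ℕ} (Γ : Set (EuclideanSpace ℝ (Fin d))) (R : ℝ) : Prop :=
  ∃ U, frontier U = Γ ∧ IsBoundedConvexDomain U ∧ RollsFreely U R

/-!
Put `δ = h₀ / lam₀`. The positivity set of `h_*` is the open `δ`-neighbourhood of `Ω`: a support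
plane decreases at rate at most `lam₀` away from `Ω`, and for a point `x` at distance at least `δ`
from `Ω` the support plane at the point of `closure Ω` nearest to `x`, descending towards `x`, is
nonpositive at `x` (`setOf_hStar_pos`). As this neighbourhood contains `closure Ω`, the free boundary
is its whole frontier (`freeBoundary_hStar`).

Its closure is the Minkowski sum of `closure Ω` and a closed ball, hence strictly convex.

For the rolling property, let `X` be a boundary point of the neighbourhood and `x₀` the point of
`closure Ω` nearest to it. Both `X - x₀` and `x₀ - Z`, where `B(Z, R)` is the ball touching at `x₀`,
are outer normals to `Ω` at `x₀`. As the boundary of `Ω` is differentiable, they point in the same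
direction (`HasC11Boundary.sameRay_of_normal`), so `‖X - Z‖ = δ + R`, while the neighbourhood lies
in `B(Z, R + δ)`. A larger radius is obtained by dilating the ball about the touching point.
-/

/-! ### Convex sets and outer normals -/

/-- The nearest point `x₀` of `closure Ω` to `x`: the vector `x - x₀` is an outer normal to `Ω`
there, in the sense that it makes no acute angle with any `y - x₀`. -/
theorem Convex.exists_mem_closure_normal {d : ℕ} {Ω : Set (EuclideanSpace ℝ (Fin d))}
    (hΩ : Convex ℝ Ω) (hne : Ω.Nonempty) (x : EuclideanSpace ℝ (Fin d)) :
    ∃ x₀ ∈ closure Ω, ‖x - x₀‖ = Metric.infDist x Ω ∧ ∀ y ∈ Ω, ⟪x - x₀, y - x₀⟫ ≤ 0 := by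
  obtain ⟨x₀, hx₀, h⟩ := exists_norm_eq_iInf_of_complete_convex hne.closure
    isClosed_closure.isComplete hΩ.closure x
  refine ⟨x₀, hx₀, ?_, fun y hy => ?_⟩
  · rw [h, ← Metric.infDist_closure, Metric.infDist_eq_iInf]
    simp only [dist_eq_norm]
  · exact (norm_eq_iInf_iff_real_inner_le_zero hΩ.closure hx₀).1 h y (subset_closure hy)

theorem IsOpen.notMem_of_normal {d : ℕ} {Ω : Set (EuclideanSpace ℝ (Fin d))} (hΩ : IsOpen Ω)
    {x₀ n : EuclideanSpace ℝ (Fin d)} (hn : n ≠ 0) (h : ∀ y ∈ Ω, ⟪n, y - x₀⟫ ≤ 0) : x₀ ∉ Ω := by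
  intro hx₀
  have hcont : Filter.Tendsto (fun t : ℝ => x₀ + t • n) (nhdsWithin 0 (Set.Ioi 0)) (nhds x₀) := by
    have : Continuous fun t : ℝ => x₀ + t • n := by fun_prop
    simpa using (this.tendsto 0).mono_left nhdsWithin_le_nhds
  obtain ⟨t, ht, ht0⟩ :=
    ((hcont.eventually (hΩ.mem_nhds hx₀)).and self_mem_nhdsWithin).exists
  have h1 := h _ ht
  rw [add_sub_cancel_left, inner_smul_right] at h1
  have h2 : 0 < ⟪n, n⟫ := real_inner_self_pos.2 hn
  have h3 : (0 : ℝ) < t := ht0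
  nlinarith [mul_pos h3 h2]

/-- Outer normals at a boundary point are unique up to scaling: near `x₀` the domain is
`{ψ < 0}` for a function `ψ` whose derivative `L` at `x₀` does not vanish, and any outer normal is a
nonnegative multiple of `L`. -/
theorem HasC11Boundary.sameRay_of_normal {d : ℕ} {Ω : Set (EuclideanSpace ℝ (Fin d))}
    (hC : HasC11Boundary Ω) {x₀ n m : EuclideanSpace ℝ (Fin d)} (hx₀ : x₀ ∈ frontier Ω)
    (hn : ∀ y ∈ Ω, ⟪n, y - x₀⟫ ≤ 0) (hm : ∀ y ∈ Ω, ⟪m, y - x₀⟫ ≤ 0)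
    (hn0 : n ≠ 0) (hm0 : m ≠ 0) : SameRay ℝ n m := by
  obtain ⟨e, φ, r, he, hr, hφ, -, hloc⟩ := hC x₀ hx₀
  set ψ : EuclideanSpace ℝ (Fin d) → ℝ := fun x => φ (x - ⟪e, x⟫ • e) - ⟪e, x⟫ with hψ
  have hdφ : Differentiable ℝ φ := hφ.differentiable (by simp)
  have hdψ : Differentiable ℝ ψ := by
    have h1 : Differentiable ℝ fun x : EuclideanSpace ℝ (Fin d) => ⟪e, x⟫ :=
      (innerSL ℝ e).differentiable
    exact (hdφ.comp (differentiable_id.sub (h1.smul_const e))).sub h1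
  have hmem : ∀ x ∈ Metric.ball x₀ r, x ∈ Ω ↔ ψ x < 0 := fun x hx => by
    rw [hloc x hx, hψ, sub_neg]
  have hψ0 : ψ x₀ ≤ 0 := by
    by_contra! hpos
    obtain ⟨y, hy, hyΩ⟩ := mem_closure_iff_nhds.1 hx₀.1 _
      (Filter.inter_mem (Metric.ball_mem_nhds x₀ hr) (hdψ.continuous.isOpen_preimage _
        isOpen_Ioi |>.mem_nhds (show x₀ ∈ ψ ⁻¹' Set.Ioi 0 from hpos)))
    exact absurd ((hmem y hy.1).1 hyΩ) (not_lt.2 (le_of_lt hy.2))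
  set L := fderiv ℝ ψ x₀
  have hline : ∀ v, HasDerivAt (fun t : ℝ => ψ (x₀ + t • v)) (L v) 0 := fun v => by
    have h2 : HasDerivAt (fun t : ℝ => x₀ + t • v) v 0 := by
      simpa using ((hasDerivAt_id (0 : ℝ)).smul_const v).const_add x₀
    have h3 : HasFDerivAt ψ L (x₀ + (0 : ℝ) • v) := by simpa using (hdψ x₀).hasFDerivAt
    exact h3.comp_hasDerivAt 0 h2
  -- Along `e` the projection is constant, so `ψ` has slope `-1` there.
  have hLe : L e = -1 := by
    refine (hline e).unique ?_
    have hfun : (fun t : ℝ => ψ (x₀ + t • e)) = fun t => ψ x₀ - t := by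
      funext t
      have hee : ⟪e, x₀ + t • e⟫ = ⟪e, x₀⟫ + t := by
        rw [inner_add_right, inner_smul_right, real_inner_self_eq_norm_sq, he]; ring
      simp only [hψ, hee]
      rw [show x₀ + t • e - (⟪e, x₀⟫ + t) • e = x₀ - ⟪e, x₀⟫ • e by module]
      ring
    rw [hfun]
    simpa using (hasDerivAt_id (0 : ℝ)).const_sub (ψ x₀)
  -- A direction of descent of `ψ` enters `Ω`.
  have hdesc : ∀ w, (∀ y ∈ Ω, ⟪w, y - x₀⟫ ≤ 0) → ∀ v, L v < 0 → ⟪w, v⟫ ≤ 0 := by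
    intro w hw v hv
    have hslope := (hline v).tendsto_slope_zero_right
    have hcont : Filter.Tendsto (fun t : ℝ => x₀ + t • v) (nhdsWithin 0 (Set.Ioi 0))
        (nhds x₀) := by
      have : Continuous fun t : ℝ => x₀ + t • v := by fun_prop
      simpa using (this.tendsto 0).mono_left nhdsWithin_le_nhds
    obtain ⟨t, ⟨ht1, ht2⟩, ht0⟩ := (((hslope.eventually (gt_mem_nhds hv)).and
      (hcont.eventually (Metric.ball_mem_nhds x₀ hr))).and self_mem_nhdsWithin).exists
    have ht : (0 : ℝ) < t := ht0
    have hneg : ψ (x₀ + t • v) < 0 := by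
      simp only [zero_add, zero_smul, add_zero, smul_eq_mul] at ht1
      by_contra! hge
      exact absurd ht1 (not_lt.2 (mul_nonneg (inv_nonneg.2 ht.le) (by linarith)))
    have h1 := hw _ ((hmem _ ht2).2 hneg)
    rw [add_sub_cancel_left, inner_smul_right] at h1
    exact nonpos_of_mul_nonpos_right h1 ht
  -- A direction `v` tangent to `ψ = 0` is a limit of the directions of descent `v + t • e`.
  have hker : ∀ w, (∀ y ∈ Ω, ⟪w, y - x₀⟫ ≤ 0) → ∀ v, L v = 0 → ⟪w, v⟫ ≤ 0 := by
    intro w hw v hv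
    have hlim : Filter.Tendsto (fun t : ℝ => ⟪w, v + t • e⟫) (nhdsWithin 0 (Set.Ioi 0))
        (nhds ⟪w, v⟫) := by
      have : Continuous fun t : ℝ => ⟪w, v + t • e⟫ := by fun_prop
      simpa using (this.tendsto 0).mono_left nhdsWithin_le_nhds
    refine le_of_tendsto hlim ?_
    filter_upwards [self_mem_nhdsWithin] with t ht
    have ht' : (0 : ℝ) < t := ht
    refine hdesc w hw _ ?_
    simp [hv, hLe, ht']
  have hrep : ∀ w, (∀ y ∈ Ω, ⟪w, y - x₀⟫ ≤ 0) → ∀ v, ⟪w, v⟫ = -⟪w, e⟫ * L v := by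
    intro w hw v
    have hL : L (v + L v • e) = 0 := by simp [hLe]
    have h1 := hker w hw _ hL
    have h2 := hker w hw (-(v + L v • e)) (by rw [map_neg, hL, neg_zero])
    rw [inner_neg_right] at h2
    rw [inner_add_right, inner_smul_right] at h1 h2
    linarith
  have hpos : ∀ w, w ≠ 0 → (∀ y ∈ Ω, ⟪w, y - x₀⟫ ≤ 0) → 0 < -⟪w, e⟫ := by
    intro w hw0 hw
    refine lt_of_le_of_ne (by have := hdesc w hw e (by simp [hLe]); linarith) fun h0 => hw0 ?_
    have := hrep w hw w
    rw [← h0, zero_mul] at this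
    exact inner_self_eq_zero.1 this
  refine Or.inr (Or.inr ⟨-⟪m, e⟫, -⟪n, e⟫, hpos m hm0 hm, hpos n hn0 hn, ?_⟩)
  refine ext_inner_right ℝ fun v => ?_
  rw [real_inner_smul_left, real_inner_smul_left, hrep n hn v, hrep m hm v]
  ring

/-! ### The positivity set of the envelope -/

/-- The support plane at the point of `closure Ω` nearest to `x`, descending towards `x`. -/
theorem exists_isSupportPlane_planeThrough_eq {d : ℕ} {Ω : Set (EuclideanSpace ℝ (Fin d))}
    (hΩ : IsBoundedConvexDomain Ω) {lam : ℝ} (hlam : 0 ≤ lam) (h₀ : ℝ)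
    {x : EuclideanSpace ℝ (Fin d)} (hx : 0 < Metric.infDist x Ω) :
    ∃ x₀ p, IsSupportPlane Ω h₀ lam x₀ p ∧
      planeThrough h₀ x₀ p x = h₀ - lam * Metric.infDist x Ω := by
  obtain ⟨x₀, hx₀, hd, hn⟩ := hΩ.convex.exists_mem_closure_normal hΩ.nonempty x
  rw [← hd] at hx ⊢
  have hnorm : ‖x - x₀‖ ≠ 0 := hx.ne'
  refine ⟨x₀, (-(lam / ‖x - x₀‖)) • (x - x₀), ⟨?_, ?_, fun y hy => ?_⟩, ?_⟩
  · rw [hΩ.isOpen.frontier_eq]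
    exact ⟨hx₀, hΩ.isOpen.notMem_of_normal (norm_ne_zero_iff.1 hnorm) hn⟩
  · rw [norm_smul, norm_neg, Real.norm_of_nonneg (by positivity)]
    field_simp
  · rw [planeThrough, real_inner_smul_left]
    have := mul_nonneg (div_nonneg hlam hx.le) (neg_nonneg.2 (hn y hy))
    linarith
  · rw [planeThrough, real_inner_smul_left, real_inner_self_eq_norm_sq]
    field_simp
    ring

theorem IsSupportPlane.le_planeThrough {d : ℕ} {Ω : Set (EuclideanSpace ℝ (Fin d))}
    {h₀ lam : ℝ} {x₀ p x y : EuclideanSpace ℝ (Fin d)} (h : IsSupportPlane Ω h₀ lam x₀ p)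
    (hy : y ∈ Ω) : h₀ - lam * dist x y ≤ planeThrough h₀ x₀ p x := by
  have h1 := h.2.2 y hy
  have h2 := neg_le_of_abs_le (abs_real_inner_le_norm p (x - y))
  rw [h.2.1, ← dist_eq_norm] at h2
  have h3 : ⟪p, x - x₀⟫ = ⟪p, y - x₀⟫ + ⟪p, x - y⟫ := by
    rw [← inner_add_right]; congr 1; abel
  rw [planeThrough] at h1 ⊢
  linarith

theorem setOf_hStar_pos {d : ℕ} (hd : 1 ≤ d) {Ω : Set (EuclideanSpace ℝ (Fin d))}
    (hΩ : IsBoundedConvexDomain Ω) {h₀ lam : ℝ} (hh₀ : 0 < h₀) (hlam : 0 < lam) :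
    {x | 0 < hStar Ω h₀ lam x} = Metric.thickening (h₀ / lam) Ω := by
  have hδ : 0 < h₀ / lam := div_pos hh₀ hlam
  ext x
  rw [Set.mem_ofPred_eq]
  refine ⟨fun hx => ?_, fun hx => ?_⟩
  · by_contra hnot
    rw [Metric.mem_thickening_iff_infDist_lt hΩ.nonempty, not_lt] at hnot
    obtain ⟨x₀, p, hp, hval⟩ :=
      exists_isSupportPlane_planeThrough_eq hΩ hlam.le h₀ (hδ.trans_le hnot)
    obtain ⟨y, hy⟩ := hΩ.nonempty
    -- Without a lower bound the infimum would take the junk value `0`.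
    have hbdd : BddBelow {t : ℝ | ∃ x₀ p, IsSupportPlane Ω h₀ lam x₀ p ∧
        t = planeThrough h₀ x₀ p x} := by
      refine ⟨h₀ - lam * dist x y, ?_⟩
      rintro _ ⟨x₁, p₁, hp₁, rfl⟩
      exact hp₁.le_planeThrough hy
    have hle : hStar Ω h₀ lam x ≤ _ := csInf_le hbdd ⟨x₀, p, hp, rfl⟩
    rw [hval] at hle
    rw [div_le_iff₀' hlam] at hnot
    linarith
  · obtain ⟨y, hy, hxy⟩ := Metric.mem_thickening_iff.1 hx
    rw [lt_div_iff₀' hlam] at hxy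
    refine (sub_pos.2 hxy).trans_le (le_csInf ?_ ?_)
    · -- In positive dimension there are points away from the bounded set `Ω`, hence planes.
      have : Nonempty (Fin d) := ⟨⟨0, hd⟩⟩
      have hcl : closure Ω ≠ Set.univ := fun h =>
        NormedSpace.unbounded_univ ℝ (EuclideanSpace ℝ (Fin d)) (h ▸ hΩ.isBounded.closure)
      obtain ⟨z, hz⟩ := (Set.ne_univ_iff_exists_notMem _).1 hcl
      have hz' : 0 < Metric.infDist z Ω := by
        rw [← Metric.infDist_closure]
        exact (isClosed_closure.notMem_iff_infDist_pos hΩ.nonempty.closure).1 hz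
      obtain ⟨x₀, p, hp, -⟩ := exists_isSupportPlane_planeThrough_eq hΩ hlam.le h₀ hz'
      exact ⟨_, x₀, p, hp, rfl⟩
    · rintro _ ⟨x₁, p₁, hp₁, rfl⟩
      exact hp₁.le_planeThrough hy

theorem freeBoundary_hStar {d : ℕ} (hd : 1 ≤ d) {Ω : Set (EuclideanSpace ℝ (Fin d))}
    (hΩ : IsBoundedConvexDomain Ω) {h₀ lam : ℝ} (hh₀ : 0 < h₀) (hlam : 0 < lam) :
    freeBoundary Ω (hStar Ω h₀ lam) = frontier (Metric.thickening (h₀ / lam) Ω) := by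
  rw [freeBoundary, setOf_hStar_pos hd hΩ hh₀ hlam, sdiff_eq_left]
  refine Set.disjoint_of_subset_right (Metric.closure_subset_thickening (div_pos hh₀ hlam) Ω) ?_
  exact (disjoint_frontier_iff_isOpen.2 Metric.isOpen_thickening)

/-! ### Neighbourhoods of convex domains -/

theorem IsBoundedConvexDomain.thickening {d : ℕ} {Ω : Set (EuclideanSpace ℝ (Fin d))}
    (hΩ : IsBoundedConvexDomain Ω) {δ : ℝ} (hδ : 0 < δ) :
    IsBoundedConvexDomain (Metric.thickening δ Ω) :=
  ⟨Metric.isOpen_thickening, hΩ.nonempty.mono (Metric.self_subset_thickening hδ Ω),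
    hΩ.isBounded.thickening, hΩ.convex.thickening δ⟩

theorem IsStrictlyConvexDomain.thickening {d : ℕ} {Ω : Set (EuclideanSpace ℝ (Fin d))}
    (hΩ : IsStrictlyConvexDomain Ω) {δ : ℝ} (hδ : 0 < δ) :
    IsStrictlyConvexDomain (Metric.thickening δ Ω) := by
  refine ⟨hΩ.1.thickening hδ, ?_⟩
  rw [closure_thickening hδ, ← Metric.cthickening_closure,
    ← hΩ.1.isBounded.isCompact_closure.add_closedBall_zero hδ.le]
  exact hΩ.2.add (strictConvex_closedBall ℝ 0 δ)

theorem RollsFreely.thickening {d : ℕ} {Ω : Set (EuclideanSpace ℝ (Fin d))}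
    (hΩ : IsBoundedConvexDomain Ω) (hC : HasC11Boundary Ω) {R δ : ℝ} (hR : 0 < R) (hδ : 0 < δ)
    (hroll : RollsFreely Ω R) : RollsFreely (Metric.thickening δ Ω) (R + δ) := by
  intro X hX
  have hXδ : Metric.infDist X Ω = δ := by
    have h := Metric.frontier_thickening_subset Ω hX
    rw [Set.mem_ofPred_eq] at h
    rw [Metric.infDist, h, ENNReal.toReal_ofReal hδ.le]
  obtain ⟨x₀, hx₀, hd, hn⟩ := hΩ.convex.exists_mem_closure_normal hΩ.nonempty X
  rw [hXδ] at hd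
  have hn0 : X - x₀ ≠ 0 := norm_ne_zero_iff.1 (hd ▸ hδ.ne')
  have hfr : x₀ ∈ frontier Ω := by
    rw [hΩ.isOpen.frontier_eq]
    exact ⟨hx₀, hΩ.isOpen.notMem_of_normal hn0 hn⟩
  obtain ⟨Z, hsub, hZ⟩ := hroll x₀ hfr
  rw [mem_sphere_iff_norm] at hZ
  have hm0 : x₀ - Z ≠ 0 := norm_ne_zero_iff.1 (hZ ▸ hR.ne')
  have hm : ∀ y ∈ Ω, ⟪x₀ - Z, y - x₀⟫ ≤ 0 := by
    intro y hy
    have h1 : ‖y - Z‖ < R := mem_ball_iff_norm.1 (hsub hy)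
    have h2 := norm_add_sq_real (x₀ - Z) (y - x₀)
    rw [show x₀ - Z + (y - x₀) = y - Z by abel, hZ] at h2
    nlinarith [norm_nonneg (y - Z), sq_nonneg ‖y - x₀‖]
  have hray := hC.sameRay_of_normal hfr hn hm hn0 hm0
  refine ⟨Z, fun x hx => ?_, ?_⟩
  · obtain ⟨y, hy, hxy⟩ := Metric.mem_thickening_iff.1 hx
    have h1 := Metric.mem_ball.1 (hsub hy)
    have h2 := dist_triangle x y Z
    rw [Metric.mem_ball]
    linarith
  · rw [mem_sphere_iff_norm, show X - Z = (X - x₀) + (x₀ - Z) by abel, hray.norm_add, hd, hZ,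
      add_comm]

/-- A larger ball touching at the same point is the image of the smaller one under the dilation of
ratio `R' / R` about that point. -/
theorem RollsFreely.mono {d : ℕ} {Ω : Set (EuclideanSpace ℝ (Fin d))} {R R' : ℝ}
    (h : RollsFreely Ω R) (hR : 0 < R) (hRR' : R ≤ R') : RollsFreely Ω R' := by
  intro X hX
  obtain ⟨Z, hsub, hZ⟩ := h X hX
  rw [mem_sphere_iff_norm] at hZ
  refine ⟨X + (R' / R) • (Z - X), fun x hx => ?_, ?_⟩
  · have h1 : ‖x - Z‖ < R := mem_ball_iff_norm.1 (hsub hx)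
    have h2 : x - (X + (R' / R) • (Z - X)) = (x - Z) + (R' / R - 1) • (X - Z) := by module
    have h3 : 0 ≤ R' / R - 1 := sub_nonneg.2 ((one_le_div hR).2 hRR')
    rw [mem_ball_iff_norm, h2]
    calc ‖(x - Z) + (R' / R - 1) • (X - Z)‖ ≤ ‖x - Z‖ + (R' / R - 1) * R := by
          refine (norm_add_le _ _).trans_eq ?_
          rw [norm_smul, Real.norm_of_nonneg h3, hZ]
      _ < R + (R' / R - 1) * R := by gcongr
      _ = R' := by field_simp; ring
  · rw [mem_sphere_iff_norm, show X - (X + (R' / R) • (Z - X)) = (R' / R) • (X - Z) by module,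
      norm_smul, hZ, Real.norm_of_nonneg (div_nonneg (hR.le.trans hRR') hR.le)]
    field_simp

/-! ### The free boundary -/

theorem mainTheorem3 {d : ℕ} (hd : 1 ≤ d) (Ω : Set (EuclideanSpace ℝ (Fin d)))
    (hΩ : IsStrictlyConvexDomain Ω) (hC11 : HasC11Boundary Ω)
    (h₀ lam₀ : ℝ) (hh₀ : 0 < h₀) (hlam₀ : 0 < lam₀) :
    IsStrictlyConvexSurface (freeBoundary Ω (hStar Ω h₀ lam₀)) ∧
      ∀ R : ℝ, 0 < R → RollsFreely Ω R →
        SurfaceRollsFreely (freeBoundary Ω (hStar Ω h₀ lam₀)) (R + h₀ / lam₀) ∧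
        (1 ≤ R → SurfaceRollsFreely (freeBoundary Ω (hStar Ω h₀ lam₀))
          (R * (lam₀ + h₀) / lam₀)) := by
  have hδ : 0 < h₀ / lam₀ := div_pos hh₀ hlam₀
  rw [freeBoundary_hStar hd hΩ.1 hh₀ hlam₀]
  refine ⟨⟨_, rfl, hΩ.thickening hδ⟩, fun R hR hroll => ?_⟩
  have hT := hroll.thickening hΩ.1 hC11 hR hδ
  refine ⟨⟨_, rfl, hΩ.1.thickening hδ, hT⟩, fun h1 => ⟨_, rfl, hΩ.1.thickening hδ, ?_⟩⟩
  refine hT.mono (by positivity) ?_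
  rw [show R * (lam₀ + h₀) / lam₀ = R + R * (h₀ / lam₀) by field_simp]
  nlinarith
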